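/- Let $Q$ be a probability measure on $\mathbb{R}^p$ and let $l:\mathbb{R}^p\times\mathbb{R}^p\to\mathbb{R}$ be a loss function such that $l(\theta,\cdot)$ is $Q$-integrable for every $\theta$; put $g(\theta)=\int l(\theta,u)\,Q(du)$. Assume that $l(\cdot,u)$ is twice continuously differentiable for every $u$, and write $\nabla l(\theta,u)$ for its gradient in $\theta$. Assume further that there is a function $h_1>0$ with $$|\nabla l(\theta_1,u)-\nabla l(\theta_2,u)|\le h_1(u)\,|\theta_1-\theta_2|\qquad\text{for all }\theta_1,\theta_2,u\in\mathbb{R}^p,$$ with $\int \exp(\tilde\gamma h_1(u))\,Q(du)<\infty$ for some $\tilde\gamma>0$, and that $\int|\nabla l(\theta_0,u)|^3\,Q(du)<\infty$ for some $\theta_0\in\mathbb{R}^p$. Let $\sigma^2(\theta)$ be the covariance matrix of $\nabla l(\theta,U)$, $U\sim Q$. Let $m=m(n)$ be a sequence of natural numbers with $m\to\infty$ and $m/n\to\gamma^*$ as $n\to\infty$, where $0\le\gamma^*<1$. Let $\nu$ be a sub-Gaussian probability law on $\mathbb{R}$ with mean $\mu$ and variance $1$ that does not depend on $n$. For each $n$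 let $X=(X_1,\dots,X_n)^{\mathsf T}$ have iid entries with law $\nu$, let $u_1,\dots,u_n$ be iid with law $Q$, and let $w=(w_1,\dots,w_n)^{\mathsf T}$ be a random vector that is independent of $(u_1,\dots,u_n)$ and that, whenever $n\ge 2$ and $1\le m\le n$, satisfies almost surely $$w=\sqrt{\frac{n-m}{mn(n-1)}}\,\Bigl(I-\frac1n\mathbf 1\mathbf 1^{\mathsf T}\Bigr)X+\frac1n\mathbf 1,$$ where $\mathbf 1=(1,\dots,1)^{\mathsf T}\in\mathbb{R}^n$. (The random vectors for different $n$ may live on different probability spaces.) Then for every $\theta\in\mathbb{R}^p$ $$\sqrt m\,\Bigl(\sum_{i=1}^n w_i\nabla l(\theta,u_i)-\nabla g(\theta)\Bigr)\xrightarrow{\ d\ }N(0,\sigma^2(\theta))\qquad\text{as }n\to\infty .$$ -/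

import Mathlib

open MeasureTheory ProbabilityTheory Filter Topology
open scoped NNReal Matrix

noncomputable section

/-- The gradient `∇ l(θ, u)` of the loss function in its first argument `θ`. -/
def lossGrad {p : ℕ} (l : EuclideanSpace ℝ (Fin p) → EuclideanSpace ℝ (Fin p) → ℝ)
    (θ u : EuclideanSpace ℝ (Fin p)) : EuclideanSpace ℝ (Fin p) :=
  gradient (fun θ' => l θ' u) θ

/-- The covariance matrix `σ²(θ) = Var(∇ l(θ, U))`, where `U` has distribution `Q`. -/
def gradCov {p : ℕ} (l : EuclideanSpace ℝ (Fin p) → EuclideanSpace ℝ (Fin p) → ℝ)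
    (Q : Measure (EuclideanSpace ℝ (Fin p))) (θ : EuclideanSpace ℝ (Fin p)) :
    Matrix (Fin p) (Fin p) ℝ :=
  Matrix.of fun i j => cov[fun u => lossGrad l θ u i, fun u => lossGrad l θ u j; Q]

/-- The matrix `Σ^{1/2} = √((n - m) / (m n (n - 1))) (I - (1/n) 𝟏 𝟏ᵀ)`, for `2 ≤ n` and
`1 ≤ m ≤ n`. -/
def weightCovSqrt (n m : ℕ) : Matrix (Fin n) (Fin n) ℝ :=
  √(((n : ℝ) - m) / (m * n * (n - 1))) •
    ((1 : Matrix (Fin n) (Fin n) ℝ) - (1 / (n : ℝ)) • Matrix.of fun _ _ => (1 : ℝ))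

end

/-!
The weights satisfy `∑ wᵢ = 1` almost surely, so with `aᵢ = √m wᵢ` the vector in question is
`∑ aᵢ (∇l(θ, uᵢ) - ∇g(θ))`, where `∇g(θ) = ∫ ∇l(θ, u) Q(du)` by differentiation under the integral
sign (`inner_gradient_integral_eq`). Its projection on a fixed direction `t` is a sum `∑ aᵢ Yᵢ` of
iid centred real variables with variance `v = tᵀ σ²(θ) t` and finite third moment, weighted by
variables independent of them. By Lévy's continuity theorem it suffices that
`E exp(i ∑ aᵢ Yᵢ) → exp(-v / 2)`.

Integrating out the `Yᵢ` first turns the left-hand side into `E ∏ φ(aᵢ)`, with `φ` the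
characteristic function of `Y₁`. As `φ(b) = exp(-v b² / 2) + O(|b|³)` uniformly in `b`, and as
`x ↦ exp(-x)` is `1`-Lipschitz on `[0, ∞)`, the distance to the limit is at most
`C E ∑ |aᵢ|³ + (v / 2) E |∑ aᵢ² - 1|` (`norm_integral_exp_sum_sub_le`).

Finally `aᵢ = d (Xᵢ - X̄) + √m / n` with `d² = (n - m) / (n (n - 1))`, so `∑ aᵢ² - 1` is
`(n - m) / n` times the error of the sample variance of `X`. Both error terms are `O(1 / √n)`, with
constants that depend only on the first four moments of `ν` (`exists_scaled_weight_moment_le`).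
-/

/-! ### Characteristic functions of randomly weighted sums -/

/-- A bound valid on the whole line: the Taylor estimate for `|x| ≤ 1`, the triangle inequality
beyond. -/
lemma norm_exp_mul_I_sub_le (x : ℝ) :
    ‖Complex.exp (x * Complex.I) - (1 + x * Complex.I - (x : ℂ) ^ 2 / 2)‖ ≤ 4 * |x| ^ 3 := by
  rcases le_or_gt |x| 1 with hx | hx
  · have h := Complex.exp_bound (x := x * Complex.I) (by simpa using hx) (n := 3) (by norm_num)
    have hs : ∑ k ∈ Finset.range 3, (x * Complex.I) ^ k / (k.factorial : ℂ)
        = 1 + x * Complex.I - (x : ℂ) ^ 2 / 2 := by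
      simp [Finset.sum_range_succ, mul_pow]
      ring
    rw [hs] at h
    refine h.trans ?_
    have h3 : 0 ≤ |x| ^ 3 := by positivity
    norm_num [Nat.factorial]
    linarith
  · have h1 : ‖Complex.exp (x * Complex.I)‖ = 1 := Complex.norm_exp_ofReal_mul_I x
    have h2 : ‖1 + x * Complex.I - (x : ℂ) ^ 2 / 2‖ ≤ 1 + |x| + |x| ^ 2 / 2 := by
      refine (norm_sub_le _ _).trans (add_le_add ((norm_add_le _ _).trans ?_) ?_) <;> simp
    refine (norm_sub_le _ _).trans ?_
    rw [h1]
    nlinarith [pow_le_pow_right₀ hx.le (show 1 ≤ 3 by norm_num),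
      pow_le_pow_right₀ hx.le (show 2 ≤ 3 by norm_num), one_le_pow₀ (n := 3) hx.le]

lemma norm_charFun_sub_quadratic_le (η : Measure ℝ) [IsProbabilityMeasure η]
    (h3 : MemLp (fun x : ℝ => x) 3 η) (h0 : ∫ x, x ∂η = 0) (a : ℝ) :
    ‖charFun η a - (1 - (((∫ x, x ^ 2 ∂η) * a ^ 2 / 2 : ℝ) : ℂ))‖ ≤
      4 * (∫ x, |x| ^ 3 ∂η) * |a| ^ 3 := by
  have hi1 : Integrable (fun x : ℝ => x) η := h3.integrable (by norm_num)
  have hi2 : Integrable (fun x : ℝ => x ^ 2) η := (h3.mono_exponent (by norm_num)).integrable_sq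
  have hi3 : Integrable (fun x : ℝ => |x| ^ 3) η := h3.integrable_norm_pow (by norm_num)
  have hq : Integrable (fun x : ℝ => 1 + ((a * x : ℝ) : ℂ) * Complex.I
      - ((a * x : ℝ) : ℂ) ^ 2 / 2) η := by
    refine ((integrable_const _).add ((hi1.const_mul a).ofReal.mul_const _)).sub ?_
    refine Integrable.div_const ?_ _
    have := (hi2.const_mul (a ^ 2)).ofReal (𝕜 := ℂ)
    refine this.congr (ae_of_all _ fun x => ?_)
    simp [mul_pow]
  have hqi : ∫ x : ℝ, (1 + ((a * x : ℝ) : ℂ) * Complex.I - ((a * x : ℝ) : ℂ) ^ 2 / 2) ∂η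
      = 1 - (((∫ x, x ^ 2 ∂η) * a ^ 2 / 2 : ℝ) : ℂ) := by
    have e : ∀ x : ℝ, 1 + ((a * x : ℝ) : ℂ) * Complex.I - ((a * x : ℝ) : ℂ) ^ 2 / 2
        = 1 + ((x : ℝ) : ℂ) * (a * Complex.I) - ((x ^ 2 : ℝ) : ℂ) * (a ^ 2 / 2) := by
      intro x; push_cast; ring
    simp_rw [e]
    rw [integral_sub, integral_add, integral_mul_const, integral_mul_const,
      integral_complex_ofReal, integral_complex_ofReal, h0]
    · simp; ring
    · exact integrable_const _
    · exact hi1.ofReal.mul_const _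
    · exact (integrable_const _).add (hi1.ofReal.mul_const _)
    · exact hi2.ofReal.mul_const _
  have he : Integrable (fun x : ℝ => Complex.exp (((a * x : ℝ) : ℂ) * Complex.I)) η := by
    refine Integrable.of_bound (C := 1) (by fun_prop) (ae_of_all _ fun x => ?_)
    rw [Complex.norm_exp_ofReal_mul_I]
  rw [charFun_apply_real, ← hqi]
  simp_rw [← Complex.ofReal_mul]
  rw [← integral_sub he hq, mul_right_comm, ← integral_const_mul]
  refine norm_integral_le_of_norm_le (hi3.const_mul _) (ae_of_all _ fun x => ?_)
  refine (norm_exp_mul_I_sub_le (a * x)).trans_eq ?_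
  rw [abs_mul]; ring

/-- A centred law with a finite third moment has the characteristic function of the Gaussian law
with the same variance, up to a cubic error. The bound holds for all arguments, not only near `0`.
-/
lemma exists_norm_charFun_sub_exp_le (η : Measure ℝ) [IsProbabilityMeasure η]
    (h3 : MemLp (fun x : ℝ => x) 3 η) (h0 : ∫ x, x ∂η = 0) :
    ∃ C : ℝ, 0 ≤ C ∧ ∀ a : ℝ,
      ‖charFun η a - (Real.exp (-((∫ x, x ^ 2 ∂η) * a ^ 2 / 2)) : ℝ)‖ ≤ C * |a| ^ 3 := by
  set v : ℝ := ∫ x, x ^ 2 ∂η with hv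
  have hv0 : 0 ≤ v := integral_nonneg fun x => sq_nonneg x
  -- both laws have the same second-order expansion, so it is compared with that of the Gaussian
  set G : Measure ℝ := gaussianReal 0 v.toNNReal
  have hG3 : MemLp (fun x : ℝ => x) 3 G := memLp_id_gaussianReal 3
  have hG0 : ∫ x, x ∂G = 0 := integral_id_gaussianReal
  have hGv : ∫ x, x ^ 2 ∂G = v := by
    have h := variance_of_integral_eq_zero (X := fun x : ℝ => x) (μ := G) aemeasurable_id hG0
    have h' : Var[fun x => x; G] = v := by
      rw [variance_fun_id_gaussianReal, Real.coe_toNNReal _ hv0]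
    rw [← h', h]
  refine ⟨4 * (∫ x, |x| ^ 3 ∂η) + 4 * (∫ x, |x| ^ 3 ∂G), ?_, fun a => ?_⟩
  · have : ∀ ρ : Measure ℝ, 0 ≤ ∫ x, |x| ^ 3 ∂ρ := fun ρ => integral_nonneg fun x => by positivity
    linarith [this η, this G]
  · have hη := norm_charFun_sub_quadratic_le η h3 h0 a
    have hg := norm_charFun_sub_quadratic_le G hG3 hG0 a
    rw [hGv] at hg
    have hc : charFun G a = (Real.exp (-(v * a ^ 2 / 2)) : ℝ) := by
      rw [charFun_gaussianReal, Real.coe_toNNReal _ hv0]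
      push_cast
      congr 1
      simp
    rw [hc] at hg
    rw [add_mul]
    exact (norm_sub_le_norm_sub_add_norm_sub _ _ _).trans
      (add_le_add hη ((norm_sub_rev _ _).trans_le hg))

lemma norm_prod_sub_prod_le_sum {ι : Type*} (s : Finset ι) (z w : ι → ℂ)
    (hz : ∀ i, ‖z i‖ ≤ 1) (hw : ∀ i, ‖w i‖ ≤ 1) :
    ‖∏ i ∈ s, z i - ∏ i ∈ s, w i‖ ≤ ∑ i ∈ s, ‖z i - w i‖ := by
  classical
  induction s using Finset.induction_on with
  | empty => simp
  | insert i s hi ih =>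
    rw [Finset.prod_insert hi, Finset.prod_insert hi, Finset.sum_insert hi]
    have hs : ‖∏ i ∈ s, w i‖ ≤ 1 := by
      rw [norm_prod]; exact Finset.prod_le_one (fun _ _ => norm_nonneg _) fun i _ => hw i
    calc ‖z i * ∏ i ∈ s, z i - w i * ∏ i ∈ s, w i‖
        = ‖z i * (∏ i ∈ s, z i - ∏ i ∈ s, w i) + (z i - w i) * ∏ i ∈ s, w i‖ := by ring_nf
      _ ≤ ‖z i‖ * ‖∏ i ∈ s, z i - ∏ i ∈ s, w i‖ + ‖z i - w i‖ * ‖∏ i ∈ s, w i‖ := by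
        refine (norm_add_le _ _).trans_eq ?_
        rw [norm_mul, norm_mul]
      _ ≤ 1 * ‖∏ i ∈ s, z i - ∏ i ∈ s, w i‖ + ‖z i - w i‖ * 1 := by
        gcongr; exact hz i
      _ ≤ ‖z i - w i‖ + ∑ i ∈ s, ‖z i - w i‖ := by linarith

lemma abs_exp_neg_sub_exp_neg_le {x y : ℝ} (hx : 0 ≤ x) (hy : 0 ≤ y) :
    |Real.exp (-x) - Real.exp (-y)| ≤ |x - y| := by
  wlog h : x ≤ y generalizing x y
  · rw [abs_sub_comm, abs_sub_comm x]; exact this hy hx (le_of_not_ge h)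
  rw [abs_of_nonneg (sub_nonneg.2 (Real.exp_le_exp.2 (neg_le_neg h))), abs_of_nonpos (by linarith)]
  have h1 : Real.exp (-y) = Real.exp (-x) * Real.exp (x - y) := by rw [← Real.exp_add]; ring_nf
  have h2 := Real.add_one_le_exp (x - y)
  have h3 : Real.exp (-x) ≤ 1 := Real.exp_le_one_iff.2 (by linarith)
  have h4 := Real.exp_pos (-x)
  rw [h1]
  nlinarith

lemma measurable_prod_charFun {n : ℕ} (η : Measure ℝ) [IsProbabilityMeasure η] :
    Measurable fun b : Fin n → ℝ => ∏ i, charFun η (b i) :=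
  Finset.measurable_prod _ fun i _ => (measurable_charFun (μ := η)).comp (measurable_pi_apply i)

/-- Conditionally on the weights, the characteristic function of a weighted sum of iid variables
factorizes. -/
lemma integral_exp_sum_mul_I {Ω : Type*} [MeasurableSpace Ω] {P : Measure Ω}
    [IsProbabilityMeasure P] {n : ℕ} {η : Measure ℝ} [IsProbabilityMeasure η]
    {a : Ω → Fin n → ℝ} (ha : AEMeasurable a P) {Y : Fin n → Ω → ℝ}
    (hY : ∀ i, HasLaw (Y i) η P) (hYi : iIndepFun Y P)
    (hind : IndepFun a (fun ω i => Y i ω) P) :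
    ∫ ω, Complex.exp ((∑ i, a ω i * Y i ω : ℝ) * Complex.I) ∂P =
      ∫ ω, ∏ i, charFun η (a ω i) ∂P := by
  have hYm : AEMeasurable (fun ω i => Y i ω) P :=
    aemeasurable_pi_lambda _ fun i => (hY i).aemeasurable
  have hlaw : P.map (fun ω i => Y i ω) = Measure.pi fun _ => η := by
    rw [(iIndepFun_iff_map_fun_eq_pi_map fun i => (hY i).aemeasurable).1 hYi]
    simp_rw [(hY _).map_eq]
  have hpair := (indepFun_iff_map_prod_eq_prod_map_map ha hYm).1 hind
  rw [hlaw] at hpair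
  have := Measure.isProbabilityMeasure_map ha
  have hm : Measurable fun q : (Fin n → ℝ) × (Fin n → ℝ) =>
      Complex.exp ((∑ i, q.1 i * q.2 i : ℝ) * Complex.I) := by fun_prop
  have h1 : ∫ ω, Complex.exp ((∑ i, a ω i * Y i ω : ℝ) * Complex.I) ∂P =
      ∫ q : (Fin n → ℝ) × (Fin n → ℝ), Complex.exp ((∑ i, q.1 i * q.2 i : ℝ) * Complex.I)
        ∂(P.map fun ω => (a ω, fun i => Y i ω)) :=
    (integral_map (ha.prodMk hYm) hm.aestronglyMeasurable).symm
  have hint : Integrable (fun q : (Fin n → ℝ) × (Fin n → ℝ) =>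
      Complex.exp ((∑ i, q.1 i * q.2 i : ℝ) * Complex.I))
      ((P.map a).prod (Measure.pi fun _ => η)) := by
    refine Integrable.of_bound (C := 1) hm.aestronglyMeasurable (ae_of_all _ fun q => ?_)
    rw [Complex.norm_exp_ofReal_mul_I]
  rw [h1, hpair, integral_prod _ hint]
  have h2 : ∀ b : Fin n → ℝ, ∫ y : Fin n → ℝ, Complex.exp ((∑ i, b i * y i : ℝ) * Complex.I)
      ∂(Measure.pi fun _ => η) = ∏ i, charFun η (b i) := by
    intro b
    have := integral_fintype_prod_eq_prod (𝕜 := ℂ) (μ := fun _ : Fin n => η)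
      (f := fun i (y : ℝ) => Complex.exp ((b i : ℂ) * (y : ℂ) * Complex.I))
    simp_rw [charFun_apply_real, ← this, ← Complex.exp_sum]
    congr 1 with y
    push_cast
    rw [Finset.sum_mul]
  simp only [h2]
  refine integral_map ha ?_
  exact (measurable_prod_charFun η).aestronglyMeasurable

/-- The characteristic function, at `1`, of a randomly weighted sum of iid centred variables is
close to that of a Gaussian law as soon as `∑ |aᵢ| ^ 3` and `|∑ aᵢ ^ 2 - 1|` have small mean. -/
lemma norm_integral_exp_sum_sub_le {Ω : Type*} [MeasurableSpace Ω] {P : Measure Ω}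
    [IsProbabilityMeasure P] {n : ℕ} {η : Measure ℝ} [IsProbabilityMeasure η]
    {a : Ω → Fin n → ℝ} (ha : AEMeasurable a P) {Y : Fin n → Ω → ℝ}
    (hY : ∀ i, HasLaw (Y i) η P) (hYi : iIndepFun Y P)
    (hind : IndepFun a (fun ω i => Y i ω) P) {v C : ℝ} (hv : 0 ≤ v) (hC : 0 ≤ C)
    (hη : ∀ b : ℝ, ‖charFun η b - (Real.exp (-(v * b ^ 2 / 2)) : ℝ)‖ ≤ C * |b| ^ 3)
    {G₁ G₂ : Ω → ℝ} (hG₁ : Integrable G₁ P) (hG₂ : Integrable G₂ P)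
    (ha₁ : ∀ᵐ ω ∂P, ∑ i, |a ω i| ^ 3 ≤ G₁ ω) (ha₂ : ∀ᵐ ω ∂P, |∑ i, a ω i ^ 2 - 1| ≤ G₂ ω) :
    ‖∫ ω, Complex.exp ((∑ i, a ω i * Y i ω : ℝ) * Complex.I) ∂P - (Real.exp (-(v / 2)) : ℝ)‖ ≤
      C * ∫ ω, G₁ ω ∂P + v / 2 * ∫ ω, G₂ ω ∂P := by
  have hint : Integrable (fun ω => ∏ i, charFun η (a ω i)) P := by
    refine Integrable.of_bound (C := 1) ?_ (ae_of_all _ fun ω => ?_)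
    · exact ((measurable_prod_charFun η).comp_aemeasurable ha).aestronglyMeasurable
    · rw [norm_prod]
      exact Finset.prod_le_one (fun _ _ => norm_nonneg _) fun i _ => norm_charFun_le_one _
  have hconst : ((Real.exp (-(v / 2)) : ℝ) : ℂ) =
      ∫ _, ((Real.exp (-(v / 2)) : ℝ) : ℂ) ∂P := by simp
  rw [integral_exp_sum_mul_I ha hY hYi hind, hconst, ← integral_sub hint (integrable_const _),
    ← integral_const_mul, ← integral_const_mul,
    ← integral_add (hG₁.const_mul _) (hG₂.const_mul _)]
  refine norm_integral_le_of_norm_le ((hG₁.const_mul _).add (hG₂.const_mul _)) ?_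
  filter_upwards [ha₁, ha₂] with ω h₁ h₂
  set b := a ω
  have hprod : ∏ i, ((Real.exp (-(v * b i ^ 2 / 2)) : ℝ) : ℂ)
      = (Real.exp (-(v / 2 * ∑ i, b i ^ 2)) : ℝ) := by
    rw [← Complex.ofReal_prod, ← Real.exp_sum, Finset.mul_sum, ← Finset.sum_neg_distrib]
    congr 3
    ext i; ring
  have e₁ : ‖∏ i, charFun η (b i) - ∏ i, ((Real.exp (-(v * b i ^ 2 / 2)) : ℝ) : ℂ)‖
      ≤ C * ∑ i, |b i| ^ 3 := by
    refine (norm_prod_sub_prod_le_sum _ _ _ (fun i => norm_charFun_le_one _) fun i => ?_).trans ?_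
    · rw [Complex.norm_real, Real.norm_eq_abs, Real.abs_exp, Real.exp_le_one_iff]
      have := mul_nonneg hv (sq_nonneg (b i))
      linarith
    · rw [Finset.mul_sum]
      exact Finset.sum_le_sum fun i _ => hη _
  have e₂ : ‖((Real.exp (-(v / 2 * ∑ i, b i ^ 2)) : ℝ) : ℂ) - (Real.exp (-(v / 2)) : ℝ)‖
      ≤ v / 2 * |∑ i, b i ^ 2 - 1| := by
    rw [← Complex.ofReal_sub, Complex.norm_real, Real.norm_eq_abs]
    refine (abs_exp_neg_sub_exp_neg_le (by positivity) (by positivity)).trans_eq ?_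
    rw [show v / 2 * ∑ i, b i ^ 2 - v / 2 = v / 2 * (∑ i, b i ^ 2 - 1) by ring, abs_mul,
      abs_of_nonneg (by positivity : 0 ≤ v / 2)]
  rw [hprod] at e₁
  calc _ ≤ _ := norm_sub_le_norm_sub_add_norm_sub _ _ _
    _ ≤ _ := add_le_add e₁ e₂
    _ ≤ _ := by gcongr

/-! ### Moments of the weights -/

lemma weightCovSqrt_mulVec_apply {n m : ℕ} (hn : n ≠ 0) (x : Fin n → ℝ) (μ : ℝ) (i : Fin n) :
    (weightCovSqrt n m *ᵥ x) i =
      √(((n : ℝ) - m) / (m * n * (n - 1))) * ((x i - μ) - (∑ j, (x j - μ)) / n) := by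
  have hn' : (n : ℝ) ≠ 0 := by exact_mod_cast hn
  rw [weightCovSqrt, Matrix.smul_mulVec, Matrix.sub_mulVec, Matrix.one_mulVec, Matrix.smul_mulVec]
  have : ((Matrix.of fun _ _ => (1 : ℝ)) *ᵥ x : Fin n → ℝ) i = ∑ j, x j := by
    simp [Matrix.mulVec, dotProduct]
  simp only [Pi.smul_apply, Pi.sub_apply, smul_eq_mul, this, Finset.sum_sub_distrib,
    Finset.sum_const, Finset.card_univ, Fintype.card_fin, nsmul_eq_mul]
  field_simp
  ring

/-- The rescaled weights `√m wᵢ` are `d (zᵢ - z̄) + e`, where `z` is the centred `x`. -/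
lemma exists_scaled_weight_eq {n m : ℕ} (hn : 2 ≤ n) (hm : 1 ≤ m) (hmn : m ≤ n) :
    ∃ d e : ℝ, 0 ≤ d ∧ 0 ≤ e ∧ d ≤ 1 / √n ∧ e ≤ 1 / √n ∧ d ^ 2 * (n - 1) + n * e ^ 2 = 1 ∧
      ∀ (x : Fin n → ℝ) (μ : ℝ) (i : Fin n),
        √m * ((weightCovSqrt n m *ᵥ x) i + 1 / (n : ℝ)) =
          d * ((x i - μ) - (∑ j, (x j - μ)) / n) + e := by
  have hn' : (2 : ℝ) ≤ n := by exact_mod_cast hn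
  have hm' : (1 : ℝ) ≤ m := by exact_mod_cast hm
  have hmn' : (m : ℝ) ≤ n := by exact_mod_cast hmn
  have hn1 : (0 : ℝ) < n - 1 := by linarith
  have hn0 : (0 : ℝ) < n := by linarith
  have hm0 : (0 : ℝ) < m := by linarith
  have hd0 : 0 ≤ ((n : ℝ) - m) / (n * (n - 1)) := div_nonneg (by linarith) (by positivity)
  refine ⟨√(((n : ℝ) - m) / (n * (n - 1))), √m / n, by positivity, by positivity, ?_, ?_, ?_,
    fun x μ i => ?_⟩
  · rw [one_div, ← Real.sqrt_inv]
    refine Real.sqrt_le_sqrt ?_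
    rw [div_le_iff₀ (by positivity)]
    field_simp
    linarith
  · rw [div_le_div_iff₀ hn0 (by positivity), one_mul, ← Real.sqrt_mul hm0.le]
    exact Real.sqrt_le_iff.2 ⟨hn0.le, by nlinarith⟩
  · rw [Real.sq_sqrt hd0, div_pow, Real.sq_sqrt hm0.le]
    field_simp
    ring
  · rw [weightCovSqrt_mulVec_apply (by omega) x μ, mul_add, ← mul_assoc,
      ← Real.sqrt_mul hm0.le]
    congr 3
    · field_simp
    · ring

lemma sum_weightCovSqrt_mulVec {n m : ℕ} (hn : n ≠ 0) (x : Fin n → ℝ) :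
    ∑ i, ((weightCovSqrt n m *ᵥ x) i + 1 / (n : ℝ)) = 1 := by
  have hn' : (n : ℝ) ≠ 0 := by exact_mod_cast hn
  simp_rw [weightCovSqrt_mulVec_apply hn x 0]
  rw [Finset.sum_add_distrib, ← Finset.mul_sum, Finset.sum_sub_distrib]
  simp
  field_simp
  simp

lemma abs_add_pow_three_le (x y : ℝ) : |x + y| ^ 3 ≤ 4 * (|x| ^ 3 + |y| ^ 3) := by
  refine (pow_le_pow_left₀ (abs_nonneg _) (abs_add_le x y) 3).trans ?_
  have := add_pow_le (abs_nonneg x) (abs_nonneg y) 3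
  norm_num at this
  exact this

/-- The fluctuating part is controlled through `|z̄| ^ 3 ≤ (∑ |zᵢ| ^ 3) / n` (Jensen), and the
constant part through `n e ^ 3 ≤ 1 / √n`. -/
lemma sum_abs_pow_three_le {n : ℕ} (hn : 1 ≤ n) (z : Fin n → ℝ) {d e : ℝ} (hd : 0 ≤ d) (he : 0 ≤ e)
    (hd' : d ≤ 1 / √n) (he' : e ≤ 1 / √n) :
    ∑ i, |d * (z i - (∑ j, z j) / n) + e| ^ 3 ≤
      32 * (1 / √n) ^ 3 * ∑ i, |z i| ^ 3 + 4 * (1 / √n) := by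
  have hn0 : (0 : ℝ) < n := by exact_mod_cast hn
  set r := 1 / √(n : ℝ) with hr
  have hr2 : n * r ^ 2 = 1 := by
    rw [hr, div_pow, Real.sq_sqrt hn0.le]; field_simp
  have hmean : |(∑ j, z j) / n| ^ 3 ≤ (∑ j, |z j| ^ 3) / n := by
    have h1 : |(∑ j, z j) / n| ≤ ∑ j, (1 / (n : ℝ)) * |z j| := by
      rw [abs_div, abs_of_pos hn0, ← Finset.mul_sum, div_eq_inv_mul, one_div]
      gcongr
      exact Finset.abs_sum_le_sum_abs _ _
    have h2 := Real.pow_arith_mean_le_arith_mean_pow Finset.univ (fun _ : Fin n => 1 / (n : ℝ))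
      (fun j => |z j|) (fun _ _ => by positivity) (by simp [hn0.ne']) (fun _ _ => abs_nonneg _) 3
    refine (pow_le_pow_left₀ (abs_nonneg _) h1 3).trans (h2.trans_eq ?_)
    rw [← Finset.mul_sum]; ring
  have h1 : ∀ i, |d * (z i - (∑ j, z j) / n) + e| ^ 3 ≤
      16 * r ^ 3 * (|z i| ^ 3 + (∑ j, |z j| ^ 3) / n) + 4 * r ^ 3 := by
    intro i
    have e1 := abs_add_pow_three_le (d * (z i - (∑ j, z j) / n)) e
    have e2 := abs_add_pow_three_le (z i) (-((∑ j, z j) / n))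
    rw [abs_neg, ← sub_eq_add_neg] at e2
    rw [abs_mul, mul_pow, abs_of_nonneg hd, abs_of_nonneg he] at e1
    have e3 : d ^ 3 ≤ r ^ 3 := pow_le_pow_left₀ hd hd' 3
    have e4 : e ^ 3 ≤ r ^ 3 := pow_le_pow_left₀ he he' 3
    have e5 : d ^ 3 * |z i - (∑ j, z j) / n| ^ 3 ≤
        r ^ 3 * (4 * (|z i| ^ 3 + (∑ j, |z j| ^ 3) / n)) := by
      refine mul_le_mul e3 (e2.trans ?_) (by positivity) (by positivity)
      linarith
    linarith
  refine (Finset.sum_le_sum fun i _ => h1 i).trans_eq ?_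
  rw [Finset.sum_add_distrib, ← Finset.mul_sum, Finset.sum_add_distrib]
  simp only [Finset.sum_const, Finset.card_univ, Fintype.card_fin, nsmul_eq_mul]
  rw [mul_div_cancel₀ _ hn0.ne']
  linear_combination 4 * r * hr2

/-- By the relation between `d` and `e`, the left-hand side is
`d ^ 2 |(∑ zᵢ ^ 2 - n) - (∑ zᵢ) ^ 2 / n + 1|`. -/
lemma abs_sum_sq_sub_one_le {n : ℕ} (hn : 1 ≤ n) (z : Fin n → ℝ) {d e : ℝ} (hd : 0 ≤ d)
    (hd' : d ≤ 1 / √n) (hde : d ^ 2 * (n - 1) + n * e ^ 2 = 1) :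
    |∑ i, (d * (z i - (∑ j, z j) / n) + e) ^ 2 - 1| ≤
      (1 / √n) ^ 2 * ((1 / √n * (∑ i, z i ^ 2 - n) ^ 2 + √n) / 2 + (∑ i, z i) ^ 2 / n + 1) := by
  have hn0 : (0 : ℝ) < n := by exact_mod_cast hn
  set S := ∑ j, z j with hS
  have hsum : ∑ i, (d * (z i - S / n) + e) ^ 2 - 1 =
      d ^ 2 * ((∑ i, z i ^ 2 - n) - S ^ 2 / n + 1) := by
    have : ∀ i, (d * (z i - S / n) + e) ^ 2 = d ^ 2 * z i ^ 2 +
        (2 * d * e - 2 * d ^ 2 * (S / n)) * z i + (e - d * (S / n)) ^ 2 := fun i => by ring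
    simp_rw [this, Finset.sum_add_distrib, ← Finset.mul_sum, ← hS]
    simp only [Finset.sum_const, Finset.card_univ, Fintype.card_fin, nsmul_eq_mul]
    have h : (n : ℝ) * (e - d * (S / n)) ^ 2 = n * e ^ 2 - 2 * d * e * S + d ^ 2 * (S ^ 2 / n) := by
      field_simp
      ring
    rw [h]
    have h' : S / n * S = S ^ 2 / n := by ring
    linear_combination hde - 2 * d ^ 2 * h'
  rw [hsum, abs_mul, abs_of_nonneg (sq_nonneg d)]
  have hd2 : d ^ 2 ≤ (1 / √n) ^ 2 := pow_le_pow_left₀ hd hd' 2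
  -- `2 |x| ≤ x ^ 2 / √n + √n`, to pass from a first to a second moment
  have hamgm : ∀ x : ℝ, |x| ≤ (1 / √n * x ^ 2 + √n) / 2 := by
    intro x
    have hs : 0 < √(n : ℝ) := Real.sqrt_pos.2 hn0
    rw [← sq_abs x, le_div_iff₀ two_pos, one_div, inv_mul_eq_div, div_add' _ _ _ hs.ne',
      le_div_iff₀ hs]
    nlinarith [sq_nonneg (|x| - √n)]
  refine mul_le_mul hd2 ?_ (abs_nonneg _) (by positivity)
  refine (abs_add_le _ _).trans (add_le_add ((abs_sub _ _).trans ?_) (by simp))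
  rw [abs_of_nonneg (by positivity : 0 ≤ S ^ 2 / n)]
  gcongr
  exact hamgm _

section Moments

variable {Ω : Type*} [MeasurableSpace Ω] {P : Measure Ω} {n : ℕ} {ν : Measure ℝ}
  {X : Fin n → Ω → ℝ}

lemma memLp_comp_of_hasLaw {f : ℝ → ℝ} {q : ENNReal} (hf : MemLp f q ν) {Y : Ω → ℝ}
    (hY : HasLaw Y ν P) : MemLp (fun ω => f (Y ω)) q P := by
  rw [← hY.map_eq] at hf
  exact hf.comp_of_map hY.aemeasurable

lemma integral_comp_of_hasLaw {f : ℝ → ℝ} (hf : AEStronglyMeasurable f ν) {Y : Ω → ℝ}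
    (hY : HasLaw Y ν P) : ∫ ω, f (Y ω) ∂P = ∫ x, f x ∂ν :=
  hY.integral_comp hf

lemma integrable_sq_sum_sub [IsProbabilityMeasure P] (hX : ∀ i, HasLaw (X i) ν P)
    {f : ℝ → ℝ} (hf2 : MemLp f 2 ν) (c : ℝ) :
    Integrable (fun ω => (∑ i, f (X i ω) - c) ^ 2) P :=
  ((memLp_finsetSum _ fun i _ => memLp_comp_of_hasLaw hf2 (hX i)).sub (memLp_const c)).integrable_sq

/-- The variance of a sum of iid variables `f (Xᵢ)`. -/
lemma integral_sq_sum_sub [IsProbabilityMeasure P] (hX : ∀ i, HasLaw (X i) ν P)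
    (hXi : iIndepFun X P) {f : ℝ → ℝ}
    (hf : Measurable f) (hf2 : MemLp f 2 ν) :
    ∫ ω, (∑ i, f (X i ω) - n * ∫ x, f x ∂ν) ^ 2 ∂P = n * Var[f; ν] := by
  have hL : ∀ i, MemLp (fun ω => f (X i ω)) 2 P := fun i => memLp_comp_of_hasLaw hf2 (hX i)
  have hvar := IndepFun.variance_sum (X := fun i ω => f (X i ω)) (s := Finset.univ) (μ := P)
    (fun i _ => hL i) fun i _ j _ hij => (hXi.indepFun hij).comp hf hf
  have hmean : P[∑ i, fun ω => f (X i ω)] = n * ∫ x, f x ∂ν := by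
    simp_rw [Finset.sum_apply]
    rw [integral_finsetSum _ fun i _ => (hL i).integrable (by norm_num)]
    simp [integral_comp_of_hasLaw hf2.aestronglyMeasurable (hX _)]
  have hv : ∀ i, Var[fun ω => f (X i ω); P] = Var[f; ν] := by
    intro i
    rw [← (hX i).map_eq, variance_map hf.aemeasurable (hX i).aemeasurable]
    rfl
  rw [variance_eq_integral (Finset.aemeasurable_sum _ fun i _ => (hL i).aemeasurable),
    hmean] at hvar
  simp only [Finset.sum_apply, hv, Finset.sum_const, Finset.card_univ, Fintype.card_fin,
    nsmul_eq_mul] at hvar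
  exact hvar

end Moments

/-- The two error terms are of order `1 / √n`, with a constant that depends on `ν` only. -/
lemma exists_scaled_weight_moment_le (ν : Measure ℝ) [IsProbabilityMeasure ν] (μ : ℝ)
    (hmean : ∫ x, x ∂ν = μ) (hvar : Var[fun x => x; ν] = 1) (h4 : MemLp (fun x => x - μ) 4 ν) :
    ∃ B₁ B₂ : ℝ, ∀ {Ω : Type*} [MeasurableSpace Ω] (P : Measure Ω) [IsProbabilityMeasure P]
      {n m : ℕ}, 2 ≤ n → 1 ≤ m → m ≤ n → ∀ {X : Fin n → Ω → ℝ}, (∀ i, HasLaw (X i) ν P) →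
      iIndepFun X P → ∀ {W : Ω → Fin n → ℝ},
      (∀ᵐ ω ∂P, W ω = weightCovSqrt n m *ᵥ (fun i => X i ω) + fun _ => 1 / (n : ℝ)) →
      ∃ G₁ G₂ : Ω → ℝ, Integrable G₁ P ∧ Integrable G₂ P ∧
        (∀ᵐ ω ∂P, ∑ i, |√m * W ω i| ^ 3 ≤ G₁ ω) ∧
        (∀ᵐ ω ∂P, |∑ i, (√m * W ω i) ^ 2 - 1| ≤ G₂ ω) ∧
        ∫ ω, G₁ ω ∂P = B₁ * (1 / √n) ∧ ∫ ω, G₂ ω ∂P ≤ B₂ * (1 / √n) := by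
  have h2 : MemLp (fun x => x - μ) 2 ν := h4.mono_exponent (by norm_num)
  have h3 : MemLp (fun x => x - μ) 3 ν := h4.mono_exponent (by norm_num)
  have hx2 : MemLp (fun x => (x - μ) ^ 2) 2 ν := by
    rw [memLp_two_iff_integrable_sq (by fun_prop)]
    refine (h4.integrable_norm_pow (p := 4) (by norm_num)).congr (ae_of_all _ fun x => ?_)
    simp only [Real.norm_eq_abs]
    rw [(by decide : Even 4).pow_abs, ← pow_mul]
  have hc0 : ∫ x, (x - μ) ∂ν = 0 := by
    have : Integrable (fun x : ℝ => x) ν := by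
      refine ((h2.integrable (by norm_num)).add (integrable_const μ)).congr (ae_of_all _ fun x => ?_)
      simp
    rw [integral_sub this (integrable_const _), hmean]; simp
  have hc2 : ∫ x, (x - μ) ^ 2 ∂ν = 1 := by
    rw [← hvar, variance_eq_integral (by fun_prop), hmean]
  have hvc : Var[fun x => x - μ; ν] = 1 := by
    rw [variance_of_integral_eq_zero (by fun_prop) hc0, hc2]
  refine ⟨32 * (∫ x, |x - μ| ^ 3 ∂ν) + 4, (Var[fun x => (x - μ) ^ 2; ν] + 1) / 2 + 2, ?_⟩
  intro Ω _ P _ n m hn hm hmn X hX hXi W hW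
  have hn0 : (0 : ℝ) < n := by exact_mod_cast (by omega : 0 < n)
  obtain ⟨d, e, hd, he, hd', he', hde, hw⟩ := exists_scaled_weight_eq hn hm hmn
  have hi3 : Integrable (fun x => |x - μ| ^ 3) ν := h3.integrable_norm_pow (by norm_num)
  have hI3 : ∀ i, Integrable (fun ω => |X i ω - μ| ^ 3) P := fun i =>
    (memLp_comp_of_hasLaw h3 (hX i)).integrable_norm_pow (by norm_num)
  have hS : Integrable (fun ω => (∑ i, (X i ω - μ)) ^ 2) P := by
    simpa using integrable_sq_sum_sub hX h2 0
  have hS' : ∫ ω, (∑ i, (X i ω - μ)) ^ 2 ∂P = n := by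
    have := integral_sq_sum_sub hX hXi (f := fun x => x - μ) (by fun_prop) h2
    simpa [hc0, hvc] using this
  have hT : Integrable (fun ω => (∑ i, (X i ω - μ) ^ 2 - n) ^ 2) P :=
    integrable_sq_sum_sub hX hx2 n
  have hT' : ∫ ω, (∑ i, (X i ω - μ) ^ 2 - n) ^ 2 ∂P = n * Var[fun x => (x - μ) ^ 2; ν] := by
    have := integral_sq_sum_sub hX hXi (f := fun x => (x - μ) ^ 2) (by fun_prop) hx2
    simpa [hc2] using this
  have hr2 : (1 / √(n : ℝ)) ^ 2 = 1 / n := by rw [div_pow, Real.sq_sqrt hn0.le, one_pow]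
  have hr3 : (1 / √(n : ℝ)) ^ 3 * n = 1 / √n := by
    rw [pow_succ, hr2]; field_simp
  refine ⟨fun ω => 32 * (1 / √n) ^ 3 * ∑ i, |X i ω - μ| ^ 3 + 4 * (1 / √n),
    fun ω => (1 / √n) ^ 2 * ((1 / √n * (∑ i, (X i ω - μ) ^ 2 - n) ^ 2 + √n) / 2 +
      (∑ i, (X i ω - μ)) ^ 2 / n + 1), ?_, ?_, ?_, ?_, ?_, ?_⟩
  · exact ((integrable_finsetSum _ fun i _ => hI3 i).const_mul _).add (integrable_const _)
  · exact (((((hT.const_mul _).add (integrable_const _)).div_const _).add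
      (hS.div_const _)).add (integrable_const _)).const_mul _
  · filter_upwards [hW] with ω h
    rw [h]
    simp_rw [Pi.add_apply, hw (fun i => X i ω) μ]
    exact sum_abs_pow_three_le (by omega) (fun i => X i ω - μ) hd he hd' he'
  · filter_upwards [hW] with ω h
    rw [h]
    simp_rw [Pi.add_apply, hw (fun i => X i ω) μ]
    exact abs_sum_sq_sub_one_le (by omega) (fun i => X i ω - μ) hd hd' hde
  · rw [integral_add ((integrable_finsetSum _ fun i _ => hI3 i).const_mul _) (integrable_const _),
      integral_const_mul, integral_finsetSum _ fun i _ => hI3 i]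
    simp_rw [integral_comp_of_hasLaw hi3.aestronglyMeasurable (hX _)]
    simp only [Finset.sum_const, Finset.card_univ, Fintype.card_fin, nsmul_eq_mul, integral_const,
      probReal_univ, smul_eq_mul, one_mul]
    linear_combination (32 * ∫ x, |x - μ| ^ 3 ∂ν) * hr3
  · rw [integral_const_mul, integral_add, integral_add, integral_div, integral_div, integral_add,
      integral_const_mul, hT', hS']
    · simp only [integral_const, probReal_univ, smul_eq_mul, one_mul, div_self hn0.ne']
      have hs : 0 < √(n : ℝ) := Real.sqrt_pos.2 hn0
      have hr1 : 1 / √(n : ℝ) ≤ 1 := by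
        rw [div_le_one hs]
        exact Real.one_le_sqrt.2 (by exact_mod_cast (by omega : 1 ≤ n))
      have hr0 : 0 < 1 / √(n : ℝ) := by positivity
      have e1 : (1 / √(n : ℝ)) ^ 2 * √n = 1 / √n := by field_simp
      have e2 : (1 / √(n : ℝ)) ^ 2 ≤ 1 / √n := by nlinarith
      linear_combination (Var[fun x => (x - μ) ^ 2; ν] / 2) * hr3 + e1 / 2 + 2 * e2
    · exact hT.const_mul _
    · exact integrable_const _
    · exact ((hT.const_mul _).add (integrable_const _)).div_const _
    · exact hS.div_const _
    · exact (((hT.const_mul _).add (integrable_const _)).div_const _).add (hS.div_const _)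
    · exact integrable_const _

/-! ### The gradient of the loss -/

section Gradient

variable {p : ℕ} {l : EuclideanSpace ℝ (Fin p) → EuclideanSpace ℝ (Fin p) → ℝ}
  {Q : Measure (EuclideanSpace ℝ (Fin p))}

lemma innerSL_lossGrad (θ u : EuclideanSpace ℝ (Fin p)) :
    innerSL ℝ (lossGrad l θ u) = fderiv ℝ (fun θ' => l θ' u) θ := by
  ext v
  rw [innerSL_apply_apply, lossGrad, inner_gradient_left]

/-- Directional derivatives are limits of difference quotients, hence inherit measurability in `u`.
-/
lemma aemeasurable_inner_lossGrad (hl : ∀ θ, AEMeasurable (l θ) Q)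
    (hd : ∀ u, Differentiable ℝ fun θ => l θ u) (θ v : EuclideanSpace ℝ (Fin p)) :
    AEMeasurable (fun u => inner ℝ (lossGrad l θ u) v) Q := by
  refine aemeasurable_of_tendsto_metrizable_ae atTop
    (f := fun (k : ℕ) u => (k : ℝ) • (l (θ + (k : ℝ)⁻¹ • v) u - l θ u))
    (fun k => ((hl (θ + (k : ℝ)⁻¹ • v)).sub (hl θ)).const_smul (k : ℝ)) (ae_of_all _ fun u => ?_)
  rw [lossGrad, inner_gradient_left]
  refine ((hd u θ).hasFDerivAt).lim v ?_
  simpa using tendsto_natCast_atTop_atTop (R := ℝ)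

lemma aemeasurable_lossGrad (hl : ∀ θ, AEMeasurable (l θ) Q)
    (hd : ∀ u, Differentiable ℝ fun θ => l θ u) (θ : EuclideanSpace ℝ (Fin p)) :
    AEMeasurable (lossGrad l θ) Q := by
  have h : AEMeasurable (fun u i => lossGrad l θ u i) Q := by
    refine aemeasurable_pi_lambda _ fun i => ?_
    refine (aemeasurable_inner_lossGrad hl hd θ (EuclideanSpace.single i 1)).congr
      (ae_of_all _ fun u => ?_)
    simp [EuclideanSpace.inner_single_right]
  exact (WithLp.measurable_toLp 2 _).comp_aemeasurable h

/-- The integrability of `exp (c h)` also yields the measurability of `h`. -/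
lemma memLp_three_of_integrable_exp {Ω : Type*} [MeasurableSpace Ω] {P : Measure Ω} {h : Ω → ℝ}
    (hpos : ∀ ω, 0 < h ω) {c : ℝ} (hc : 0 < c) (hint : Integrable (fun ω => Real.exp (c * h ω)) P) :
    MemLp h 3 P := by
  have hm : AEMeasurable h P := by
    refine ((Real.measurable_log.comp_aemeasurable hint.aemeasurable).const_mul c⁻¹).congr
      (ae_of_all _ fun ω => ?_)
    simp [hc.ne']
  have h3 : Integrable (fun ω => ‖h ω‖ ^ (3 : ENNReal).toReal) P := by
    refine (hint.const_mul (6 / c ^ 3)).mono' (hm.norm.pow_const _).aestronglyMeasurable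
      (ae_of_all _ fun ω => ?_)
    have h0 := hpos ω
    have := Real.pow_div_factorial_le_exp (c * h ω) (by positivity) 3
    rw [div_le_iff₀ (by positivity)] at this
    have e : ‖h ω‖ ^ (3 : ENNReal).toReal = h ω ^ 3 := by
      rw [Real.norm_of_nonneg h0.le, ENNReal.toReal_ofNat]
      exact Real.rpow_natCast (h ω) 3
    rw [e, Real.norm_of_nonneg (by positivity), div_mul_eq_mul_div, le_div_iff₀ (by positivity)]
    norm_num [Nat.factorial] at this
    linarith
  exact (integrable_norm_rpow_iff hm.aestronglyMeasurable (by norm_num) (by norm_num)).1 h3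

lemma memLp_lossGrad (hl : ∀ θ, AEMeasurable (l θ) Q)
    (hd : ∀ u, Differentiable ℝ fun θ => l θ u) {h₁ : EuclideanSpace ℝ (Fin p) → ℝ}
    (hlip : ∀ u θ₁ θ₂, ‖lossGrad l θ₁ u - lossGrad l θ₂ u‖ ≤ h₁ u * ‖θ₁ - θ₂‖)
    (hh : MemLp h₁ 3 Q) {θ₀ : EuclideanSpace ℝ (Fin p)} (h₀ : MemLp (fun u => lossGrad l θ₀ u) 3 Q)
    (θ : EuclideanSpace ℝ (Fin p)) : MemLp (lossGrad l θ) 3 Q := by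
  refine MemLp.of_le (h₀.norm.add (hh.mul_const ‖θ - θ₀‖))
    (aemeasurable_lossGrad hl hd θ).aestronglyMeasurable (ae_of_all _ fun u => ?_)
  refine le_trans ?_ (le_abs_self _)
  have := norm_le_norm_add_norm_sub' (lossGrad l θ u) (lossGrad l θ₀ u)
  exact this.trans (by simpa using hlip u θ θ₀)

/-- Differentiation under the integral sign. -/
lemma inner_gradient_integral_eq (hl : ∀ θ, Integrable (l θ) Q)
    (hd : ∀ u, Differentiable ℝ fun θ => l θ u) {h₁ : EuclideanSpace ℝ (Fin p) → ℝ}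
    (hlip : ∀ u θ₁ θ₂, ‖lossGrad l θ₁ u - lossGrad l θ₂ u‖ ≤ h₁ u * ‖θ₁ - θ₂‖)
    (hpos : ∀ u, 0 < h₁ u) (hh : Integrable h₁ Q) {θ : EuclideanSpace ℝ (Fin p)}
    (hθ : Integrable (lossGrad l θ) Q) (t : EuclideanSpace ℝ (Fin p)) :
    inner ℝ (gradient (fun θ => ∫ u, l θ u ∂Q) θ) t = ∫ u, inner ℝ (lossGrad l θ u) t ∂Q := by
  have hF : Integrable (fun u => innerSL ℝ (lossGrad l θ u)) Q :=
    (innerSL ℝ).integrable_comp hθ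
  have key := hasFDerivAt_integral_of_dominated_of_fderiv_le (𝕜 := ℝ) (μ := Q) (F := l) (x₀ := θ)
    (F' := fun θ u => innerSL ℝ (lossGrad l θ u)) (s := Metric.ball θ 1)
    (bound := fun u => ‖lossGrad l θ u‖ + h₁ u) (Metric.ball_mem_nhds θ one_pos)
    (Eventually.of_forall fun θ' => (hl θ').aestronglyMeasurable) (hl θ) hF.aestronglyMeasurable
    (ae_of_all _ fun u x hx => ?_) (hθ.norm.add hh) (ae_of_all _ fun u x _ => ?_)
  · rw [inner_gradient_left, key.fderiv, ContinuousLinearMap.integral_apply hF]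
    simp only [innerSL_apply_apply]
  · rw [innerSL_apply_norm]
    refine (norm_le_norm_add_norm_sub' (lossGrad l x u) (lossGrad l θ u)).trans ?_
    gcongr
    refine (hlip u x θ).trans (mul_le_of_le_one_right (hpos u).le ?_)
    rw [← dist_eq_norm]
    exact (Metric.mem_ball.1 hx).le
  · simp only [innerSL_lossGrad]
    exact (hd u x).hasFDerivAt

lemma dotProduct_gradCov_mulVec [IsProbabilityMeasure Q] {θ : EuclideanSpace ℝ (Fin p)}
    (h : MemLp (lossGrad l θ) 2 Q) (t : Fin p → ℝ) :
    t ⬝ᵥ gradCov l Q θ *ᵥ t = Var[fun u => ∑ i, t i * lossGrad l θ u i; Q] := by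
  have hi : ∀ i, MemLp (fun u => lossGrad l θ u i) 2 Q := fun i =>
    h.of_le ((EuclideanSpace.proj (𝕜 := ℝ) i).continuous.comp_aestronglyMeasurable h.1)
      (ae_of_all _ fun u => PiLp.norm_apply_le _ i)
  have hti : ∀ i, MemLp (fun u => t i * lossGrad l θ u i) 2 Q := fun i => (hi i).const_mul (t i)
  rw [← covariance_self (memLp_finsetSum _ fun i _ => hti i).1.aemeasurable,
    covariance_fun_sum_fun_sum hti hti]
  simp_rw [covariance_const_mul_left, covariance_const_mul_right, dotProduct, Matrix.mulVec,
    dotProduct, Finset.mul_sum, gradCov, Matrix.of_apply]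
  refine Finset.sum_congr rfl fun i _ => Finset.sum_congr rfl fun j _ => ?_
  ring

lemma posSemidef_gradCov [IsProbabilityMeasure Q] {θ : EuclideanSpace ℝ (Fin p)}
    (h : MemLp (lossGrad l θ) 2 Q) : (gradCov l Q θ).PosSemidef := by
  refine Matrix.PosSemidef.of_dotProduct_mulVec_nonneg ?_ fun t => ?_
  · ext i j
    simp [gradCov, covariance_comm]
  · rw [star_trivial, dotProduct_gradCov_mulVec h]
    exact variance_nonneg _ _

end Gradient

/-! ### Convergence in distribution -/

/-- The projection of `∑ Wᵢ V(uᵢ) - c` on `t` is a randomly weighted sum of iid real variables,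
because the weights add up to `1`. -/
lemma norm_charFun_smul_weighted_sum_sub_le {Ω 𝓧 E : Type*} [MeasurableSpace Ω]
    [MeasurableSpace 𝓧] [NormedAddCommGroup E] [InnerProductSpace ℝ E] [MeasurableSpace E]
    [BorelSpace E] [SecondCountableTopology E] {P : Measure Ω} [IsProbabilityMeasure P]
    {Q : Measure 𝓧} [IsProbabilityMeasure Q] {n : ℕ} {W : Ω → Fin n → ℝ} (hW : AEMeasurable W P)
    {u : Fin n → Ω → 𝓧}
    (hu : ∀ i, HasLaw (u i) Q P) (hui : iIndepFun u P) (hWu : IndepFun W (fun ω i => u i ω) P)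
    (hW1 : ∀ᵐ ω ∂P, ∑ i, W ω i = 1) {V : 𝓧 → E} {c t : E} {s : ℝ}
    (hY : AEMeasurable (fun x => inner ℝ (V x) t - inner ℝ c t) Q)
    (hS : AEMeasurable (fun ω => s • ((∑ i, W ω i • V (u i ω)) - c)) P) {v C : ℝ} (hv : 0 ≤ v)
    (hC : 0 ≤ C) (hη : ∀ b : ℝ, ‖charFun (Q.map fun x => inner ℝ (V x) t - inner ℝ c t) b -
      (Real.exp (-(v * b ^ 2 / 2)) : ℝ)‖ ≤ C * |b| ^ 3)
    {G₁ G₂ : Ω → ℝ} (hG₁ : Integrable G₁ P) (hG₂ : Integrable G₂ P)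
    (ha₁ : ∀ᵐ ω ∂P, ∑ i, |s * W ω i| ^ 3 ≤ G₁ ω)
    (ha₂ : ∀ᵐ ω ∂P, |∑ i, (s * W ω i) ^ 2 - 1| ≤ G₂ ω) :
    ‖charFun (P.map fun ω => s • ((∑ i, W ω i • V (u i ω)) - c)) t - (Real.exp (-(v / 2)) : ℝ)‖ ≤
      C * ∫ ω, G₁ ω ∂P + v / 2 * ∫ ω, G₂ ω ∂P := by
  set Y : 𝓧 → ℝ := fun x => inner ℝ (V x) t - inner ℝ c t with hYdef
  have hYm : ∀ i, AEMeasurable Y (P.map (u i)) := fun i => (hu i).map_eq ▸ hY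
  have hlaw : ∀ i, HasLaw (Y ∘ u i) (Q.map Y) P := fun i => HasLaw.comp ⟨hY, rfl⟩ (hu i)
  have hind : iIndepFun (fun i => Y ∘ u i) P :=
    hui.comp₀ (fun _ => Y) (fun i => (hu i).aemeasurable) hYm
  have hum : AEMeasurable (fun ω i => u i ω) P :=
    aemeasurable_pi_lambda _ fun i => (hu i).aemeasurable
  have hscale : Measurable fun (w : Fin n → ℝ) i => s * w i := by fun_prop
  have hYpi : AEMeasurable (fun (x : Fin n → 𝓧) i => Y (x i)) (P.map fun ω i => u i ω) := by
    refine aemeasurable_pi_lambda _ fun i => ?_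
    refine AEMeasurable.comp_aemeasurable (g := Y) (f := fun x : Fin n → 𝓧 => x i) ?_
      (measurable_pi_apply i).aemeasurable
    rw [AEMeasurable.map_map_of_aemeasurable (measurable_pi_apply i).aemeasurable hum]
    exact hYm i
  have hWY : IndepFun (fun ω i => s * W ω i) (fun ω i => (Y ∘ u i) ω) P :=
    hWu.comp₀ hW hum hscale.aemeasurable hYpi
  have : IsProbabilityMeasure (Q.map Y) := Measure.isProbabilityMeasure_map hY
  have key := norm_integral_exp_sum_sub_le (hscale.comp_aemeasurable hW) hlaw hind hWY hv hC hη
    hG₁ hG₂ ha₁ ha₂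
  have heq : charFun (P.map fun ω => s • ((∑ i, W ω i • V (u i ω)) - c)) t =
      ∫ ω, Complex.exp ((∑ i, s * W ω i * (Y ∘ u i) ω : ℝ) * Complex.I) ∂P := by
    rw [charFun_apply, integral_map hS (by fun_prop)]
    refine integral_congr_ae ?_
    filter_upwards [hW1] with ω hω
    -- the weights add up to `1`, so that the centring can be moved inside the sum
    have : inner ℝ (s • ((∑ i, W ω i • V (u i ω)) - c)) t = ∑ i, s * W ω i * (Y ∘ u i) ω := by
      simp only [hYdef, Function.comp_apply, real_inner_smul_left, inner_sub_left, sum_inner,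
        mul_sub, Finset.sum_sub_distrib, mul_assoc, ← Finset.mul_sum, ← Finset.sum_mul, hω, one_mul]
    rw [this]
  rw [heq]
  exact key

theorem theorem1
    {p : ℕ}
    -- loss function, objective function, distribution of the data
    (l : EuclideanSpace ℝ (Fin p) → EuclideanSpace ℝ (Fin p) → ℝ)
    (g : EuclideanSpace ℝ (Fin p) → ℝ)
    (Q : Measure (EuclideanSpace ℝ (Fin p))) [IsProbabilityMeasure Q]
    -- the loss is an unbiased estimator of the objective
    (hl_int : ∀ θ, Integrable (l θ) Q)
    (hg : ∀ θ, ∫ u, l θ u ∂Q = g θ)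
    -- regularity of the loss
    (hl_smooth : ∀ u, ContDiff ℝ 2 (fun θ => l θ u))
    (h₁ : EuclideanSpace ℝ (Fin p) → ℝ) (hh₁_pos : ∀ u, 0 < h₁ u)
    (hh₁_lip : ∀ u θ₁ θ₂, ‖lossGrad l θ₁ u - lossGrad l θ₂ u‖ ≤ h₁ u * ‖θ₁ - θ₂‖)
    (hh₁_exp : ∃ γ' : ℝ, 0 < γ' ∧ Integrable (fun u => Real.exp (γ' * h₁ u)) Q)
    (hl_moment : ∃ θ₀, MemLp (fun u => lossGrad l θ₀ u) 3 Q)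
    -- the regime: `m → ∞` and `m / n → γ < 1` as `n → ∞`
    (m : ℕ → ℕ) (hm : Tendsto m atTop atTop)
    (γ : ℝ) (hγ_nonneg : 0 ≤ γ) (hγ_lt : γ < 1)
    (hmn : Tendsto (fun n : ℕ => (m n : ℝ) / n) atTop (𝓝 γ))
    -- common law of the `X i`: sub-Gaussian with mean `μ` and variance `1`
    (ν : Measure ℝ) [IsProbabilityMeasure ν] (μ : ℝ)
    (hν_mean : ∫ x, x ∂ν = μ) (hν_var : Var[fun x => x; ν] = 1)
    (hν_subG : ∃ c : ℝ≥0, HasSubgaussianMGF (fun x => x - μ) c ν)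
    -- for each `n`, a probability space with `X`, the weights `W` and the data `u`
    {Ω : ℕ → Type*} [∀ n, MeasurableSpace (Ω n)]
    (P : (n : ℕ) → Measure (Ω n)) [∀ n, IsProbabilityMeasure (P n)]
    (X : (n : ℕ) → Fin n → Ω n → ℝ)
    (hX_law : ∀ n i, HasLaw (X n i) ν (P n))
    (hX_indep : ∀ n, iIndepFun (X n) (P n))
    (W : (n : ℕ) → Ω n → Fin n → ℝ)
    (hW_meas : ∀ n, AEMeasurable (W n) (P n))
    (hW : ∀ n, 2 ≤ n → 1 ≤ m n → m n ≤ n → ∀ᵐ ω ∂(P n),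
      W n ω = weightCovSqrt n (m n) *ᵥ (fun i => X n i ω) + fun _ => 1 / (n : ℝ))
    (u : (n : ℕ) → Fin n → Ω n → EuclideanSpace ℝ (Fin p))
    (hu_law : ∀ n i, HasLaw (u n i) Q (P n))
    (hu_indep : ∀ n, iIndepFun (u n) (P n))
    -- the weights are independent of the data
    (hWu_indep : ∀ n, IndepFun (W n) (fun ω i => u n i ω) (P n)) :
    ∀ θ : EuclideanSpace ℝ (Fin p),
      TendstoInDistribution
        (fun n ω => √(m n : ℝ) •
          ((∑ i : Fin n, W n ω i • lossGrad l θ (u n i ω)) - gradient g θ))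
        atTop
        (fun z : EuclideanSpace ℝ (Fin p) => z)
        P
        (multivariateGaussian 0 (gradCov l Q θ)) := by
  intro θ
  obtain ⟨γ', hγ', hexp⟩ := hh₁_exp
  obtain ⟨θ₀, hθ₀⟩ := hl_moment
  obtain ⟨c, hc⟩ := hν_subG
  have hd : ∀ u, Differentiable ℝ fun θ => l θ u := fun u => (hl_smooth u).differentiable (by simp)
  have hlm : ∀ θ, AEMeasurable (l θ) Q := fun θ => (hl_int θ).aemeasurable
  have hh3 : MemLp h₁ 3 Q := memLp_three_of_integrable_exp hh₁_pos hγ' hexp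
  have hV3 : MemLp (lossGrad l θ) 3 Q := memLp_lossGrad hlm hd hh₁_lip hh3 hθ₀ θ
  have hV2 : MemLp (lossGrad l θ) 2 Q := hV3.mono_exponent (by norm_num)
  have hV1 : Integrable (lossGrad l θ) Q := hV3.integrable (by norm_num)
  have hgrad : ∀ t, inner ℝ (gradient g θ) t = ∫ u, inner ℝ (lossGrad l θ u) t ∂Q := by
    intro t
    have hg' : g = fun θ => ∫ u, l θ u ∂Q := funext fun θ => (hg θ).symm
    rw [hg']
    exact inner_gradient_integral_eq hl_int hd hh₁_lip hh₁_pos (hh3.integrable (by norm_num)) hV1 t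
  have hVu : ∀ n i, AEMeasurable (fun ω => lossGrad l θ (u n i ω)) (P n) := fun n i =>
    AEMeasurable.comp_aemeasurable (g := lossGrad l θ) ((hu_law n i).map_eq ▸ hV1.aemeasurable)
      (hu_law n i).aemeasurable
  have hmeas : ∀ n, AEMeasurable (fun ω => √(m n : ℝ) •
      ((∑ i : Fin n, W n ω i • lossGrad l θ (u n i ω)) - gradient g θ)) (P n) := by
    intro n
    have h : AEMeasurable (fun ω => ∑ i : Fin n, W n ω i • lossGrad l θ (u n i ω)) (P n) :=
      Finset.aemeasurable_fun_sum _ fun i _ => AEMeasurable.smul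
        ((measurable_pi_apply i).comp_aemeasurable (hW_meas n)) (hVu n i)
    exact (h.sub_const (gradient g θ)).const_smul (√(m n : ℝ))
  refine ⟨hmeas, aemeasurable_id, ?_⟩
  refine ProbabilityMeasure.tendsto_iff_tendsto_charFun.2 fun t => ?_
  set Y : EuclideanSpace ℝ (Fin p) → ℝ := fun u => inner ℝ (lossGrad l θ u) t -
    inner ℝ (gradient g θ) t with hY
  have hi : ∀ {q}, MemLp (lossGrad l θ) q Q → MemLp (fun u => inner ℝ (lossGrad l θ u) t) q Q :=
    fun h => h.inner_const t
  have hY3 : MemLp Y 3 Q := (hi hV3).sub (memLp_const _)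
  have hYm : AEMeasurable Y Q := hY3.aemeasurable
  set η : Measure ℝ := Q.map Y
  have hη : IsProbabilityMeasure η := Measure.isProbabilityMeasure_map hYm
  have hη3 : MemLp (fun x : ℝ => x) 3 η :=
    (memLp_map_measure_iff aestronglyMeasurable_id hYm).2 hY3
  have hη0 : ∫ x, x ∂η = 0 := by
    rw [integral_map hYm (by fun_prop), integral_sub ((hi hV2).integrable (by norm_num))
      (integrable_const _), ← hgrad]
    simp
  have hηv : ∫ x, x ^ 2 ∂η = t ⬝ᵥ gradCov l Q θ *ᵥ t := by
    rw [dotProduct_gradCov_mulVec hV2, integral_map hYm (by fun_prop)]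
    have e : (fun u => ∑ i, t i * lossGrad l θ u i) = fun u => inner ℝ (lossGrad l θ u) t := by
      ext u; simp [PiLp.inner_apply]
    rw [e, variance_eq_integral (hi hV2).aemeasurable, ← hgrad]
  obtain ⟨C, hC, hCη⟩ := exists_norm_charFun_sub_exp_le η hη3 hη0
  set v := ∫ x, x ^ 2 ∂η
  have hv : 0 ≤ v := integral_nonneg fun x => sq_nonneg x
  have hlim : charFun (multivariateGaussian 0 (gradCov l Q θ)) t = (Real.exp (-(v / 2)) : ℝ) := by
    rw [charFun_multivariateGaussian (posSemidef_gradCov hV2), ← hηv]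
    push_cast
    simp
  obtain ⟨B₁, B₂, hB⟩ := exists_scaled_weight_moment_le ν μ hν_mean hν_var (hc.memLp 4)
  have hevent : ∀ᶠ n in atTop, 2 ≤ n ∧ 1 ≤ m n ∧ m n ≤ n := by
    filter_upwards [eventually_ge_atTop 2, hm.eventually_ge_atTop 1, hmn.eventually_lt_const hγ_lt]
      with n h2 h1 hlt
    refine ⟨h2, h1, ?_⟩
    rw [div_lt_one (by exact_mod_cast (by omega : 0 < n))] at hlt
    exact_mod_cast hlt.le
  have hbound : ∀ᶠ n : ℕ in atTop, ‖charFun ((P n).map fun ω => √(m n : ℝ) •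
      ((∑ i : Fin n, W n ω i • lossGrad l θ (u n i ω)) - gradient g θ)) t -
      (Real.exp (-(v / 2)) : ℝ)‖ ≤ (C * B₁ + v / 2 * B₂) * (1 / √(n : ℝ)) := by
    filter_upwards [hevent] with n hn
    obtain ⟨h2, h1, hle⟩ := hn
    obtain ⟨G₁, G₂, hG₁, hG₂, ha₁, ha₂, hI₁, hI₂⟩ :=
      hB (P n) h2 h1 hle (hX_law n) (hX_indep n) (hW n h2 h1 hle)
    have hw1 : ∀ᵐ ω ∂(P n), ∑ i, W n ω i = 1 := by
      filter_upwards [hW n h2 h1 hle] with ω hω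
      rw [hω]
      exact sum_weightCovSqrt_mulVec (by omega) _
    refine (norm_charFun_smul_weighted_sum_sub_le (hW_meas n) (hu_law n) (hu_indep n)
      (hWu_indep n) hw1 hYm (hmeas n) hv hC hCη hG₁ hG₂ ha₁ ha₂).trans ?_
    rw [hI₁, add_mul, mul_assoc, mul_assoc]
    gcongr
  have htend : Tendsto (fun n : ℕ => (C * B₁ + v / 2 * B₂) * (1 / √(n : ℝ))) atTop (𝓝 0) := by
    have h : Tendsto (fun n : ℕ => √(n : ℝ)) atTop atTop :=
      Real.tendsto_sqrt_atTop.comp tendsto_natCast_atTop_atTop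
    simpa using (h.inv_tendsto_atTop).const_mul (C * B₁ + v / 2 * B₂)
  have hmain := tendsto_iff_norm_sub_tendsto_zero.2
    (squeeze_zero' (Eventually.of_forall fun _ => norm_nonneg _) hbound htend)
  simp only [ProbabilityMeasure.coe_mk, Measure.map_id']
  rw [hlim]
  exact hmain
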